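/- Let $X$ be a (real or complex) Banach space and let $(P_s)_{s\in\Gamma}$ be a $1$-projectional skeleton on $X$, i.e. $\Gamma$ is an up-directed partially ordered set and the $P_s$ are bounded linear projections on $X$ with $\|P_s\|=1$ such that (i) $P_sX$ is separable for each $s\in\Gamma$; (ii) $P_sP_t=P_tP_s=P_s$ whenever $s\le t$; (iii) every increasing (not necessarily strictly) sequence $(s_n)$ in $\Gamma$ has a supremum $s$ in $\Gamma$, and $P_sX=\overline{\bigcup_n P_{s_n}X}$; (iv) $X=\bigcup_{s\in\Gamma}P_sX$. Let $D=\bigcup_{s\in\Gamma}P_s^*X^*\subset X^*$ be the induced subspace and let $\sigma(X,D)$ be the weakest topology on $X$ making all functionals from $D$ continuous. A set $\Gamma'\subset\Gamma$ is cofinal if for each $s\in\Gamma$ there is $t\in\Gamma'$ with $s\le t$; it is $\sigma$-closed if the supremum in $\Gamma$ of any increasing sequence in $\Gamma'$ belongs to $\Gamma'$. Let $A\subset\Gamma$ be a directed subset. If $A\ne\emptyset$, let $P_Ax=\lim_{s\in A}P_sx$ for $x\in X$ (the norm limit of the net indexed by $A$ exists and $P_A$ is a bounded linear projection); set $P_\emptyset=0$.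 Let $A_\sigma$ be the smallest $\sigma$-closed subset of $\Gamma$ containing $A$, and, with $Y=P_AX$, let $D_A=\bigcup_{s\in A_\sigma}(P_s|_Y)^*Y^*\subset Y^*$ if $A\neq\emptyset$, and $D_\emptyset=\{0\}$. Then the following assertions are equivalent. 1. $P_A^*(D)\subset D$. 2. The projection $P_A$ is $\sigma(X,D)$-to-$\sigma(X,D)$ continuous. 3. $P_AX$ is a $\sigma(X,D)$-closed subspace of $X$. 4. There is a cofinal $\sigma$-closed subset $\Gamma'\subset\Gamma$ such that $P_s(P_AX)\subset P_AX$ for each $s\in\Gamma'$. 5. There is a cofinal $\sigma$-closed subset $\Gamma'\subset\Gamma$ such that $P_sP_A=P_AP_s$ for each $s\in\Gamma'$. 6. $D_A=\{x^*|_{P_AX} : x^*\in D\}$. -/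

import Mathlib

open Set Filter Topology

/-- A projectional skeleton on the Banach space `X`: a family of bounded linear projections indexed
by an up-directed partially ordered set.  "Increasing" sequences are the monotone ones. -/
structure IsProjectionalSkeleton {𝕜 X Γ : Type*} [RCLike 𝕜] [NormedAddCommGroup X]
    [NormedSpace 𝕜 X] [PartialOrder Γ] (P : Γ → X →L[𝕜] X) : Prop where
  /-- the index set is up-directed -/
  directed : ∀ s t : Γ, ∃ u, s ≤ u ∧ t ≤ u
  /-- every `P s` is a projection -/
  proj : ∀ s, P s ∘L P s = P s
  /-- the range of every `P s` is separable -/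
  separable : ∀ s, TopologicalSpace.IsSeparable (range (P s))
  /-- compatibility along the order -/
  comp_eq : ∀ s t, s ≤ t → P s ∘L P t = P s ∧ P t ∘L P s = P s
  /-- suprema of increasing sequences exist, and the ranges are continuous along them -/
  exists_sup : ∀ u : ℕ → Γ, Monotone u →
    ∃ s, IsLUB (range u) s ∧ range (P s) = closure (⋃ n, range (P (u n)))
  /-- the ranges cover `X` -/
  cover : ⋃ s, range (P s) = univ

/-- A `1`-projectional skeleton: a projectional skeleton made from norm one projections. -/
structure IsOneProjectionalSkeleton {𝕜 X Γ : Type*} [RCLike 𝕜] [NormedAddCommGroup X]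
    [NormedSpace 𝕜 X] [PartialOrder Γ] (P : Γ → X →L[𝕜] X) : Prop
    extends IsProjectionalSkeleton P where
  norm_eq_one : ∀ s, ‖P s‖ = 1

/-- The subspace `D = ⋃ s, P_s^* X^*` of `X^*` induced by the family `P`; here `P_s^* f = f ∘ P_s`. -/
def inducedSubspace {𝕜 X Γ : Type*} [RCLike 𝕜] [NormedAddCommGroup X]
    [NormedSpace 𝕜 X] (P : Γ → X →L[𝕜] X) : Set (StrongDual 𝕜 X) :=
  ⋃ s, range fun f : StrongDual 𝕜 X => f ∘L P s

/-- The topology `σ(X, D)`: the weakest topology on `X` making all members of `D` continuous. -/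
abbrev sigmaTopology {𝕜 X : Type*} [RCLike 𝕜] [NormedAddCommGroup X]
    [NormedSpace 𝕜 X] (D : Set (StrongDual 𝕜 X)) : TopologicalSpace X :=
  ⨅ f ∈ D, TopologicalSpace.induced (fun x : X => f x) inferInstance

/-- A set of indices is `σ`-closed if it contains the suprema (in `Γ`) of its increasing
sequences. -/
def IsSigmaClosed {Γ : Type*} [PartialOrder Γ] (S : Set Γ) : Prop :=
  ∀ u : ℕ → Γ, Monotone u → (∀ n, u n ∈ S) → ∀ s, IsLUB (range u) s → s ∈ S

/-- `A_σ`, the smallest `σ`-closed set of indices containing `A`. -/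
def sigmaClosure {Γ : Type*} [PartialOrder Γ] (A : Set Γ) : Set Γ :=
  ⋂₀ {S | A ⊆ S ∧ IsSigmaClosed S}

open Classical in
/-- The projection `P_A x = lim_{s ∈ A} P_s x` for a nonempty directed set `A` of indices (the limit
of the net indexed by `A`), with the convention `P_∅ = 0`.  For a `1`-projectional skeleton and a
directed `A ≠ ∅` the limit always exists, see `tendsto_limitProjection`. -/
noncomputable def limitProjection {𝕜 X Γ : Type*} [RCLike 𝕜] [NormedAddCommGroup X]
    [NormedSpace 𝕜 X] [PartialOrder Γ] (P : Γ → X →L[𝕜] X) (A : Set Γ) : X →L[𝕜] X :=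
  if h : A.Nonempty ∧ ∃ T : X →L[𝕜] X,
      ∀ x, Tendsto (fun s : A => P s x) atTop (𝓝 (T x)) then h.2.choose else 0

/-- The subspace `D_A = ⋃_{s ∈ A_σ} (P_s|_Y)^* Y^*` of `Y^*`, where `Y = P_A X`, induced by the
skeleton `(P_s|_Y)_{s ∈ A_σ}` on `Y`; the map `R` below is the restriction `P_s|_Y : Y → Y`.
The functional `0` belongs to the union as soon as `A ≠ ∅`; it is added in order that `D_∅` be the
zero subspace. -/
def inducedSubspaceOn {𝕜 X Γ : Type*} [RCLike 𝕜] [NormedAddCommGroup X]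
    [NormedSpace 𝕜 X] [PartialOrder Γ] (P : Γ → X →L[𝕜] X) (A : Set Γ) :
    Set (StrongDual 𝕜 (limitProjection P A).range) :=
  {0} ∪ {g | ∃ s ∈ sigmaClosure A,
    ∃ R : (limitProjection P A).range →L[𝕜] (limitProjection P A).range,
      (∀ y, (R y : X) = P s (y : X)) ∧
        ∃ f : StrongDual 𝕜 (limitProjection P A).range, g = f ∘L R}

/-- Along an increasing sequence of indices the projections converge pointwise. -/
theorem IsOneProjectionalSkeleton.tendsto_seq {𝕜 X Γ : Type*} [RCLike 𝕜] [NormedAddCommGroup X]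
    [NormedSpace 𝕜 X] [PartialOrder Γ] {P : Γ → X →L[𝕜] X} (hP : IsOneProjectionalSkeleton P)
    (u : ℕ → Γ) (hu : Monotone u) (x : X) :
    ∃ y, Tendsto (fun n => P (u n) x) atTop (𝓝 y) := by
  obtain ⟨s, hs, hr⟩ := hP.exists_sup u hu
  refine ⟨P s x, Metric.tendsto_atTop.2 fun ε hε => ?_⟩
  have hx : P s x ∈ closure (⋃ n, range (P (u n))) := hr ▸ mem_range_self x
  obtain ⟨z, hz, hd⟩ := Metric.mem_closure_iff.1 hx (ε / 2) (half_pos hε)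
  obtain ⟨m, w, rfl⟩ := mem_iUnion.1 hz
  refine ⟨m, fun n hn => ?_⟩
  have h1 : P (u n) (P s x) = P (u n) x :=
    congrArg (fun T : X →L[𝕜] X => T x) (hP.comp_eq _ _ (hs.1 (mem_range_self n))).1
  have h2 : P (u n) (P (u m) w) = P (u m) w :=
    congrArg (fun T : X →L[𝕜] X => T w) (hP.comp_eq _ _ (hu hn)).2
  have h3 : dist (P (u n) x) (P (u m) w) ≤ dist (P s x) (P (u m) w) := by
    rw [← h1, ← h2, dist_eq_norm, dist_eq_norm, ← map_sub, h2]
    simpa [hP.norm_eq_one] using (P (u n)).le_opNorm (P s x - P (u m) w)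
  calc dist (P (u n) x) (P s x)
      ≤ dist (P (u n) x) (P (u m) w) + dist (P s x) (P (u m) w) := dist_triangle_right _ _ _
    _ < ε := by linarith

/-- The limit defining `P_A` exists. -/
theorem IsOneProjectionalSkeleton.tendsto_limitProjection {𝕜 X Γ : Type*} [RCLike 𝕜]
    [NormedAddCommGroup X] [NormedSpace 𝕜 X] [CompleteSpace X] [PartialOrder Γ]
    {P : Γ → X →L[𝕜] X} (hP : IsOneProjectionalSkeleton P) {A : Set Γ}
    (hA : DirectedOn (· ≤ ·) A) (hne : A.Nonempty) (x : X) :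
    Tendsto (fun s : A => P s x) atTop (𝓝 (limitProjection P A x)) := by
  have : Nonempty A := hne.to_subtype
  have : IsDirectedOrder A := ⟨fun a b => by
    obtain ⟨c, hc, h1, h2⟩ := hA a a.2 b b.2
    exact ⟨⟨c, hc⟩, h1, h2⟩⟩
  have key : ∀ x : X, ∀ ε > 0, ∃ s : A, ∀ t : A, s ≤ t → dist (P t x) (P s x) < ε := by
    intro x ε hε
    by_contra! H
    choose f hf hfε using H
    obtain ⟨s₀⟩ := ‹Nonempty A›
    let u : ℕ → A := fun n => f^[n] s₀
    have hsucc : ∀ n, u (n + 1) = f (u n) := fun n => Function.iterate_succ_apply' f n s₀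
    have hu : Monotone u := monotone_nat_of_le_succ fun n => by rw [hsucc]; exact hf _
    obtain ⟨y, hy⟩ := hP.tendsto_seq (fun n => (u n : Γ)) (fun a b h => hu h) x
    obtain ⟨N, hN⟩ := Metric.cauchySeq_iff.1 hy.cauchySeq ε hε
    have h1 := hN (N + 1) (Nat.le_succ N) N le_rfl
    rw [hsucc] at h1
    exact absurd h1 (not_lt.2 (hfε (u N)))
  have hlim : ∀ x : X, ∃ y, Tendsto (fun s : A => P s x) atTop (𝓝 y) := by
    intro x
    refine cauchy_map_iff_exists_tendsto.1 (Metric.cauchy_iff.2 ⟨inferInstance, fun ε hε => ?_⟩)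
    obtain ⟨s, hs⟩ := key x (ε / 2) (half_pos hε)
    refine ⟨(fun t : A => P t x) '' Ici s, image_mem_map (Ici_mem_atTop s), ?_⟩
    rintro _ ⟨a, ha, rfl⟩ _ ⟨b, hb, rfl⟩
    calc dist (P a x) (P b x) ≤ dist (P a x) (P s x) + dist (P b x) (P s x) :=
          dist_triangle_right _ _ _
      _ < ε := by linarith [hs a ha, hs b hb]
  choose T hT using hlim
  let L : X →ₗ[𝕜] X :=
    { toFun := T
      map_add' := fun a b => tendsto_nhds_unique (hT (a + b)) <| by
        simpa using (hT a).add (hT b)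
      map_smul' := fun c a => tendsto_nhds_unique (hT (c • a)) <| by
        simpa using (hT a).const_smul c }
  have hL : ∀ a, ‖L a‖ ≤ 1 * ‖a‖ := fun a =>
    le_of_tendsto (hT a).norm <| Eventually.of_forall fun s => by
      simpa [hP.norm_eq_one] using (P s).le_opNorm a
  have h : A.Nonempty ∧ ∃ T : X →L[𝕜] X,
      ∀ x, Tendsto (fun s : A => P s x) atTop (𝓝 (T x)) := ⟨hne, L.mkContinuous 1 hL, hT⟩
  rw [limitProjection, dif_pos h]
  exact h.2.choose_spec x

/-! The chain 1 → 2 → 3 is soft: `D` separates points, so the range of a `σ(X, D)`-continuous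
idempotent is an equalizer, hence closed. 3 → 4 (`isCofinal_setOf_mapsTo`) is a closing-off
argument. A point off a `σ(X, D)`-closed set is kept away from it by one seminorm `‖P r ·‖`;
separability lets countably many such `r` suffice at each stage, and they are absorbed by the
supremum of a chain. 4 → 5 and 6 rest on one fact (`exists_limitProjection_comp_eq`): for cofinally
many `t`, `P_A P_t` equals some `P_s` with `s ∈ A_σ`. Such `t` satisfy `P_A P_t P_A = P_A P_t`,
while invariance of the range gives `P_A P_t P_A = P_t P_A`; interleaving the two kinds of index
gives commutation. 5 → 1 holds because each `f ∈ D` is fixed by `P_t` for all large `t`, so `f P_A =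
f P_t P_A = f P_A P_t`. -/

theorem comp_mem_inducedSubspace {𝕜 X Γ : Type*} [RCLike 𝕜] [NormedAddCommGroup X]
    [NormedSpace 𝕜 X] {P : Γ → X →L[𝕜] X} (f : StrongDual 𝕜 X) (s : Γ) :
    f ∘L P s ∈ inducedSubspace P :=
  mem_iUnion.2 ⟨s, f, rfl⟩

/-! ### Projectional skeletons and the topology `σ(X, D)`. -/

namespace IsProjectionalSkeleton

variable {𝕜 X Γ : Type*} [RCLike 𝕜] [NormedAddCommGroup X] [NormedSpace 𝕜 X] [PartialOrder Γ]
  {P : Γ → X →L[𝕜] X}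

theorem apply_apply_of_le (hP : IsProjectionalSkeleton P) {s t : Γ} (h : s ≤ t) (x : X) :
    P s (P t x) = P s x :=
  congrArg (fun T : X →L[𝕜] X => T x) (hP.comp_eq s t h).1

theorem apply_apply_of_ge (hP : IsProjectionalSkeleton P) {s t : Γ} (h : s ≤ t) (x : X) :
    P t (P s x) = P s x :=
  congrArg (fun T : X →L[𝕜] X => T x) (hP.comp_eq s t h).2

theorem exists_apply_eq (hP : IsProjectionalSkeleton P) (x : X) : ∃ s, P s x = x := by
  have hx : x ∈ ⋃ s, range (P s) := hP.cover ▸ mem_univ x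
  obtain ⟨s, z, rfl⟩ := mem_iUnion.1 hx
  exact ⟨s, hP.apply_apply_of_le le_rfl z⟩

theorem range_eq_of_isLUB (hP : IsProjectionalSkeleton P) {u : ℕ → Γ} (hu : Monotone u) {s : Γ}
    (hs : IsLUB (range u) s) : range (P s) = closure (⋃ n, range (P (u n))) := by
  obtain ⟨s', hs', hr⟩ := hP.exists_sup u hu
  rwa [hs.unique hs']

theorem exists_ge_forall_le (hP : IsProjectionalSkeleton P) (s : Γ) (v : ℕ → Γ) :
    ∃ w, s ≤ w ∧ ∀ n, v n ≤ w := by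
  choose j hj₁ hj₂ using hP.directed
  let u : ℕ → Γ := fun n => Nat.rec s (fun k r => j r (v k)) n
  have hu : Monotone u := monotone_nat_of_le_succ fun n => hj₁ (u n) (v n)
  obtain ⟨w, hw, -⟩ := hP.exists_sup u hu
  exact ⟨w, hw.1 (mem_range_self 0), fun n =>
    (hj₂ (u n) (v n)).trans (hw.1 (mem_range_self (n + 1)))⟩

/-- If every index has a successor for the relation `r`, then every index lies below the supremum
of an increasing sequence of consecutive `r`-successors. -/
theorem exists_chain (hP : IsProjectionalSkeleton P) {r : Γ → Γ → Prop}
    (hr : ∀ s, ∃ t, s ≤ t ∧ r s t) (s : Γ) :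
    ∃ (u : ℕ → Γ) (t : Γ), u 0 = s ∧ Monotone u ∧ IsLUB (range u) t ∧
      ∀ n, r (u n) (u (n + 1)) := by
  choose g hg₁ hg₂ using hr
  let u : ℕ → Γ := fun n => Nat.rec s (fun _ r => g r) n
  have hu : Monotone u := monotone_nat_of_le_succ fun n => hg₁ (u n)
  obtain ⟨t, ht, -⟩ := hP.exists_sup u hu
  exact ⟨u, t, rfl, hu, ht, fun n => hg₂ (u n)⟩

theorem nonempty_index (hP : IsProjectionalSkeleton P) : Nonempty Γ :=
  ⟨(hP.exists_apply_eq 0).choose⟩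

theorem zero_mem_inducedSubspace (hP : IsProjectionalSkeleton P) :
    (0 : StrongDual 𝕜 X) ∈ inducedSubspace P := by
  obtain ⟨s⟩ := hP.nonempty_index
  simpa using comp_mem_inducedSubspace (P := P) 0 s

theorem exists_comp_eq (hP : IsProjectionalSkeleton P) {f : StrongDual 𝕜 X}
    (hf : f ∈ inducedSubspace P) : ∃ s, ∀ t, s ≤ t → ∀ x, f (P t x) = f x := by
  obtain ⟨s, g, rfl⟩ := mem_iUnion.1 hf
  exact ⟨s, fun t ht x => congrArg g (hP.apply_apply_of_le ht x)⟩

theorem eq_of_forall_mem_inducedSubspace (hP : IsProjectionalSkeleton P) {x y : X}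
    (h : ∀ f ∈ inducedSubspace P, f x = f y) : x = y := by
  obtain ⟨s, hs⟩ := hP.exists_apply_eq x
  obtain ⟨t, ht⟩ := hP.exists_apply_eq y
  obtain ⟨u, hsu, htu⟩ := hP.directed s t
  have hx : P u x = x := by rw [← hs, hP.apply_apply_of_ge hsu]
  have hy : P u y = y := by rw [← ht, hP.apply_apply_of_ge htu]
  rw [← hx, ← hy]
  exact (SeparatingDual.eq_iff_forall_dual_eq (R := 𝕜)).2 fun f =>
    h _ (comp_mem_inducedSubspace f u)

theorem continuous_of_mem {D : Set (StrongDual 𝕜 X)} {f : StrongDual 𝕜 X} (hf : f ∈ D) :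
    Continuous[sigmaTopology D, inferInstance] f :=
  continuous_iff_le_induced.2 (iInf₂_le f hf)

theorem continuous_sigmaTopology {D : Set (StrongDual 𝕜 X)} {T : X →L[𝕜] X}
    (h : ∀ f ∈ D, f ∘L T ∈ D) : Continuous[sigmaTopology D, sigmaTopology D] T := by
  refine continuous_iInf_rng.2 fun f => continuous_iInf_rng.2 fun hf => ?_
  exact continuous_induced_rng.2 (continuous_of_mem (h f hf))

/-- A `σ(X, D)`-continuous idempotent operator has `σ(X, D)`-closed range. -/
theorem isClosed_range_of_continuous (hP : IsProjectionalSkeleton P) {T : X →L[𝕜] X}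
    (hT : ∀ x, T (T x) = T x)
    (h : Continuous[sigmaTopology (inducedSubspace P), sigmaTopology (inducedSubspace P)] T) :
    IsClosed[sigmaTopology (inducedSubspace P)] (range T) := by
  have : range T = ⋂ f ∈ inducedSubspace P, {x | f (T x) = f x} := by
    ext x
    simp only [mem_iInter, mem_ofPred_eq]
    constructor
    · rintro ⟨z, rfl⟩ f -
      rw [hT]
    · exact fun hx => ⟨x, hP.eq_of_forall_mem_inducedSubspace hx⟩
  rw [this]
  refine @isClosed_biInter X _ (sigmaTopology (inducedSubspace P)) _ _ fun f hf => ?_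
  exact @isClosed_eq 𝕜 X _ (sigmaTopology (inducedSubspace P)) _ _ _
    (@Continuous.comp _ _ _ (_) (_) (_) _ _ (continuous_of_mem hf) h) (continuous_of_mem hf)

/-- Each member of `D` factors through some `P t`, so the seminorms `‖P t ·‖` define a topology
finer than `σ(X, D)`. They are directed in `t`, hence a single one suffices. -/
theorem exists_ball_subset_of_mem_nhds (hP : IsProjectionalSkeleton P) {x : X} {U : Set X}
    (hU : U ∈ @nhds X (sigmaTopology (inducedSubspace P)) x) :
    ∃ t, ∃ ε > 0, ∀ z, dist (P t z) (P t x) < ε → z ∈ U := by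
  have hne := hP.nonempty_index
  have hle : ⨅ t, comap (P t) (𝓝 (P t x)) ≤
      @nhds X (sigmaTopology (inducedSubspace P)) x := by
    simp only [nhds_iInf, nhds_induced]
    refine le_iInf₂ fun f hf => ?_
    obtain ⟨t, g, rfl⟩ := mem_iUnion.1 hf
    refine (iInf_le _ t).trans ?_
    have : (fun z => (g ∘L P t) z) = g ∘ P t := rfl
    rw [this, ← comap_comap]
    exact comap_mono (tendsto_iff_comap.1 (g.continuous.tendsto (P t x)))
  have hdir : Directed (· ≥ ·) fun t => comap (P t) (𝓝 (P t x)) := by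
    have hmono : ∀ s t, s ≤ t → comap (P t) (𝓝 (P t x)) ≤ comap (P s) (𝓝 (P s x)) := by
      intro s t hst
      have h₁ : (P s : X → X) = P s ∘ P t := funext fun z => (hP.apply_apply_of_le hst z).symm
      conv_rhs => rw [h₁, ← comap_comap]
      exact comap_mono (tendsto_iff_comap.1 ((P s).continuous.tendsto (P t x)))
    intro s t
    obtain ⟨u, hsu, htu⟩ := hP.directed s t
    exact ⟨u, hmono s u hsu, hmono t u htu⟩
  obtain ⟨t, ht⟩ := (mem_iInf_of_directed hdir U).1 (hle hU)
  obtain ⟨V, hV, hVU⟩ := mem_comap.1 ht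
  obtain ⟨ε, hε, hεV⟩ := Metric.mem_nhds_iff.1 hV
  exact ⟨t, ε, hε, fun z hz => hVU (hεV hz)⟩

end IsProjectionalSkeleton

/-! ### `σ`-closures and suprema of sequences. -/

section Sequences

variable {Γ : Type*} [PartialOrder Γ]

theorem subset_sigmaClosure (A : Set Γ) : A ⊆ sigmaClosure A :=
  subset_sInter fun _ h => h.1

theorem isSigmaClosed_sigmaClosure (A : Set Γ) : IsSigmaClosed (sigmaClosure A) :=
  fun u hu h s hs S hS => hS.2 u hu (fun n => h n S hS) s hs

theorem sigmaClosure_subset {A S : Set Γ} (h : A ⊆ S) (hS : IsSigmaClosed S) :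
    sigmaClosure A ⊆ S :=
  sInter_subset_of_mem ⟨h, hS⟩

theorem sigmaClosure_empty : sigmaClosure (∅ : Set Γ) = ∅ :=
  subset_empty_iff.1 <| sigmaClosure_subset Subset.rfl fun _ _ h _ _ => (h 0).elim

theorem DirectedOn.exists_monotone_seq {A : Set Γ} (hA : DirectedOn (· ≤ ·) A) {v : ℕ → Γ}
    (hv : ∀ n, v n ∈ A) :
    ∃ u : ℕ → Γ, Monotone u ∧ (∀ n, u n ∈ A) ∧ ∀ n, v n ≤ u n := by
  choose! j hj hj₁ hj₂ using hA
  let u : ℕ → Γ := fun n => Nat.rec (v 0) (fun k r => j r (v (k + 1))) n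
  have huA : ∀ n, u n ∈ A := fun n => by
    induction n with
    | zero => exact hv 0
    | succ k ih => exact hj _ ih _ (hv _)
  refine ⟨u, monotone_nat_of_le_succ fun n => hj₁ _ (huA n) _ (hv _), huA, fun n => ?_⟩
  cases n with
  | zero => exact le_rfl
  | succ k => exact hj₂ _ (huA k) _ (hv _)

/-- The suprema of the increasing sequences of elements of `A`. -/
def seqSups (A : Set Γ) : Set Γ :=
  {s | ∃ u : ℕ → Γ, Monotone u ∧ (∀ n, u n ∈ A) ∧ IsLUB (range u) s}

theorem seqSups_subset_sigmaClosure (A : Set Γ) : seqSups A ⊆ sigmaClosure A := by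
  rintro s ⟨u, hu, huA, hs⟩
  exact isSigmaClosed_sigmaClosure A u hu (fun n => subset_sigmaClosure A (huA n)) s hs

theorem subset_seqSups (A : Set Γ) : A ⊆ seqSups A := fun a ha =>
  ⟨fun _ => a, monotone_const, fun _ => ha, by simp⟩

end Sequences

/-! ### Limits along sequences and invariance of `σ(X, D)`-closed sets. -/

namespace IsOneProjectionalSkeleton

variable {𝕜 X Γ : Type*} [RCLike 𝕜] [NormedAddCommGroup X] [NormedSpace 𝕜 X] [PartialOrder Γ]
  {P : Γ → X →L[𝕜] X}

theorem dist_apply_le (hP : IsOneProjectionalSkeleton P) (s : Γ) (x y : X) :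
    dist (P s x) (P s y) ≤ dist x y := by
  rw [dist_eq_norm, dist_eq_norm, ← map_sub]
  simpa [hP.norm_eq_one] using (P s).le_opNorm (x - y)

theorem tendsto_of_isLUB (hP : IsOneProjectionalSkeleton P) {u : ℕ → Γ} (hu : Monotone u) {s : Γ}
    (hs : IsLUB (range u) s) (x : X) : Tendsto (fun n => P (u n) x) atTop (𝓝 (P s x)) := by
  refine Metric.tendsto_atTop.2 fun ε hε => ?_
  have hx : P s x ∈ closure (⋃ n, range (P (u n))) :=
    hP.range_eq_of_isLUB hu hs ▸ mem_range_self x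
  obtain ⟨z, hz, hd⟩ := Metric.mem_closure_iff.1 hx (ε / 2) (half_pos hε)
  obtain ⟨m, w, rfl⟩ := mem_iUnion.1 hz
  refine ⟨m, fun n hn => ?_⟩
  have h := hP.dist_apply_le (u n) (P s x) (P (u m) w)
  rw [hP.apply_apply_of_le (hs.1 (mem_range_self n)), hP.apply_apply_of_ge (hu hn)] at h
  calc dist (P (u n) x) (P s x)
      ≤ dist (P (u n) x) (P (u m) w) + dist (P s x) (P (u m) w) := dist_triangle_right _ _ _
    _ < ε := by linarith

/-- Continuous relations between `P s ∘ S` and `P s ∘ T` are inherited by suprema of increasing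
sequences of indices. -/
theorem isSigmaClosed_setOf_eq (hP : IsOneProjectionalSkeleton P) {φ ψ : X → X}
    (hφ : Continuous φ) (hψ : Continuous ψ) (S T : X → X) :
    IsSigmaClosed {s | ∀ x, φ (P s (S x)) = ψ (P s (T x))} := by
  intro u hu h s hs x
  exact tendsto_nhds_unique ((hφ.tendsto _).comp (hP.tendsto_of_isLUB hu hs (S x)))
    (((hψ.tendsto _).comp (hP.tendsto_of_isLUB hu hs (T x))).congr fun n => (h n x).symm)

theorem isSigmaClosed_setOf_mapsTo (hP : IsOneProjectionalSkeleton P) {Y : Set X}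
    (hY : IsClosed Y) : IsSigmaClosed {s | MapsTo (P s) Y Y} := fun _ hu h _ hs _ hy =>
  hY.mem_of_tendsto (hP.tendsto_of_isLUB hu hs _) (Eventually.of_forall fun n => h n hy)

/-- A `σ(X, D)`-closed set is mapped into itself by cofinally many projections. -/
theorem isCofinal_setOf_mapsTo (hP : IsOneProjectionalSkeleton P) {Y : Set X}
    (hY : IsClosed[sigmaTopology (inducedSubspace P)] Y) :
    IsCofinal {s | MapsTo (P s) Y Y} := by
  have hsep : ∀ s, ∃ c : ℕ → X, range (P s) ⊆ closure (range c) := fun s => by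
    obtain ⟨C, hC, hsub⟩ := hP.separable s
    have hne : C.Nonempty := by
      rw [← closure_nonempty_iff]
      exact (range_nonempty (P s)).mono hsub
    obtain ⟨c, rfl⟩ := hC.exists_eq_range hne
    exact ⟨c, hsub⟩
  choose c hc using hsep
  -- `H p m t`: the seminorm `‖P t ·‖` keeps `p` at distance at least `1 / (m + 1)` from `Y`.
  let H : X → ℕ → Γ → Prop := fun p m t => ∀ y ∈ Y, 1 / ((m : ℝ) + 1) ≤ dist (P t y) (P t p)
  have step : ∀ s, ∃ t, s ≤ t ∧ ∀ k m, (∃ r, H (c s k) m r) → ∃ r ≤ t, H (c s k) m r := by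
    intro s
    have hv : ∀ q : ℕ × ℕ, ∃ v, (∃ r, H (c s q.1) q.2 r) → H (c s q.1) q.2 v := fun q => by
      by_cases h : ∃ r, H (c s q.1) q.2 r
      · exact ⟨h.choose, fun _ => h.choose_spec⟩
      · exact ⟨s, fun h' => (h h').elim⟩
    choose v hv using hv
    obtain ⟨w, hsw, hw⟩ := hP.exists_ge_forall_le s fun n => v (Nat.unpair n)
    refine ⟨w, hsw, fun k m h => ⟨v (k, m), ?_, hv (k, m) h⟩⟩
    simpa using hw (Nat.pair k m)
  intro s₀
  obtain ⟨u, t, rfl, hu, ht, hstep⟩ := hP.exists_chain step s₀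
  refine ⟨t, fun y hy => ?_, ht.1 (mem_range_self 0)⟩
  by_contra hx
  have hU : Yᶜ ∈ @nhds X (sigmaTopology (inducedSubspace P)) (P t y) :=
    @IsOpen.mem_nhds X (sigmaTopology (inducedSubspace P)) _ _
      ((@isOpen_compl_iff X Y (sigmaTopology (inducedSubspace P))).2 hY) hx
  obtain ⟨r, ε, hε, hr⟩ := hP.exists_ball_subset_of_mem_nhds hU
  obtain ⟨m, hm⟩ := exists_nat_one_div_lt (half_pos hε)
  have hm₀ : 0 < 1 / ((m : ℝ) + 1) := Nat.one_div_pos_of_nat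
  have hmem : P t y ∈ closure (⋃ n, range (c (u n))) := by
    have h₁ : P t y ∈ closure (⋃ n, range (P (u n))) :=
      hP.range_eq_of_isLUB hu ht ▸ mem_range_self y
    refine closure_minimal (iUnion_subset fun n => ?_) isClosed_closure h₁
    exact (hc (u n)).trans (closure_mono (subset_iUnion (fun n => range (c (u n))) n))
  obtain ⟨p, hp, hd⟩ := Metric.mem_closure_iff.1 hmem _ hm₀
  obtain ⟨n, k, rfl⟩ := mem_iUnion.1 hp
  -- Half of `ε` is lost in replacing `P t y` by the nearby dense point, since `P r` is
  -- nonexpansive.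
  have hH : H (c (u n) k) m r := fun z hz => by
    have h₁ : ε ≤ dist (P r z) (P r (P t y)) := not_lt.1 fun h => hr z h hz
    have h₂ := dist_triangle_right (P r z) (P r (P t y)) (P r (c (u n) k))
    have h₃ := hP.dist_apply_le r (P t y) (c (u n) k)
    linarith
  -- The witness `r` need not lie below `t`, but its replacement `q` does. Then `P q y = P q (P t
  -- y)`, so `y ∈ Y` itself is too close to the dense point.
  obtain ⟨q, hq, hHq⟩ := hstep n k m ⟨r, hH⟩
  have h₁ := hHq y hy
  rw [← hP.apply_apply_of_le (hq.trans (ht.1 (mem_range_self (n + 1))))] at h₁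
  exact absurd (hP.dist_apply_le q (P t y) (c (u n) k)) (not_le.2 (hd.trans_le h₁))

/-- Countably many sequences in `A` are dominated by one increasing sequence in `A`. Working in
`seqSups A` avoids showing that `A_σ` is directed. -/
theorem exists_mem_seqSups_forall_le (hP : IsOneProjectionalSkeleton P) {A : Set Γ}
    (hA : DirectedOn (· ≤ ·) A) {b : ℕ → Γ} (hb : ∀ k, b k ∈ seqSups A) :
    ∃ s ∈ seqSups A, ∀ k, b k ≤ s := by
  choose a _ haA hab using hb
  obtain ⟨u, hu, huA, hle⟩ := hA.exists_monotone_seq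
    (v := fun n => a (Nat.unpair n).1 (Nat.unpair n).2) fun n => haA _ _
  obtain ⟨s, hs, -⟩ := hP.exists_sup u hu
  refine ⟨s, ⟨u, hu, huA, hs⟩, fun k => (hab k).2 ?_⟩
  rintro _ ⟨n, rfl⟩
  have h := hle (Nat.pair k n)
  simp only [Nat.unpair_pair] at h
  exact h.trans (hs.1 (mem_range_self _))

theorem limitProjection_empty : limitProjection P (∅ : Set Γ) = 0 :=
  dif_neg (by simp)

/-! ### The projection `P_A` and its interaction with the skeleton. -/

variable [CompleteSpace X] {A : Set Γ}

/-- For indices in `A` both nets are eventually constant; the identities then pass to `A_σ` because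
they define `σ`-closed sets of indices. -/
theorem limitProjection_apply_of_mem (hP : IsOneProjectionalSkeleton P)
    (hA : DirectedOn (· ≤ ·) A) {s : Γ} (hs : s ∈ sigmaClosure A) (x : X) :
    limitProjection P A (P s x) = P s x ∧ P s (limitProjection P A x) = P s x := by
  rcases A.eq_empty_or_nonempty with rfl | hne
  · simp [sigmaClosure_empty] at hs
  have : Nonempty A := hne.to_subtype
  have : IsDirectedOrder A := ⟨fun a b => by
    obtain ⟨c, hc, h₁, h₂⟩ := hA a a.2 b b.2
    exact ⟨⟨c, hc⟩, h₁, h₂⟩⟩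
  refine ⟨?_, ?_⟩
  · refine sigmaClosure_subset (fun a ha => ?_) (hP.isSigmaClosed_setOf_eq
      (limitProjection P A).continuous continuous_id id id) hs x
    intro z
    refine tendsto_nhds_unique (hP.tendsto_limitProjection hA hne (P a z))
      (tendsto_const_nhds.congr' ?_)
    filter_upwards [eventually_ge_atTop (⟨a, ha⟩ : A)] with t ht
    exact (hP.apply_apply_of_ge (show a ≤ t from ht) z).symm
  · refine sigmaClosure_subset (fun a ha => ?_) (hP.isSigmaClosed_setOf_eq
      continuous_id continuous_id (limitProjection P A) id) hs x
    intro z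
    refine tendsto_nhds_unique
      (((P a).continuous.tendsto _).comp (hP.tendsto_limitProjection hA hne z))
      (tendsto_const_nhds.congr' ?_)
    filter_upwards [eventually_ge_atTop (⟨a, ha⟩ : A)] with t ht
    exact (hP.apply_apply_of_le (show a ≤ t from ht) z).symm

theorem limitProjection_idem (hP : IsOneProjectionalSkeleton P) (hA : DirectedOn (· ≤ ·) A)
    (x : X) : limitProjection P A (limitProjection P A x) = limitProjection P A x := by
  rcases A.eq_empty_or_nonempty with rfl | hne
  · simp [limitProjection_empty]
  have : Nonempty A := hne.to_subtype
  have : IsDirectedOrder A := ⟨fun a b => by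
    obtain ⟨c, hc, h₁, h₂⟩ := hA a a.2 b b.2
    exact ⟨⟨c, hc⟩, h₁, h₂⟩⟩
  have h := hP.tendsto_limitProjection hA hne x
  exact tendsto_nhds_unique (((limitProjection P A).continuous.tendsto _).comp h) <|
    h.congr fun a => (hP.limitProjection_apply_of_mem hA (subset_sigmaClosure A a.2) x).1.symm

theorem mem_range_limitProjection (hP : IsOneProjectionalSkeleton P) (hA : DirectedOn (· ≤ ·) A)
    {x : X} : x ∈ range (limitProjection P A) ↔ limitProjection P A x = x := by
  refine ⟨?_, fun h => ⟨x, h⟩⟩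
  rintro ⟨z, rfl⟩
  exact hP.limitProjection_idem hA z

theorem isClosed_range_limitProjection (hP : IsOneProjectionalSkeleton P)
    (hA : DirectedOn (· ≤ ·) A) : IsClosed (range (limitProjection P A)) := by
  have : range (limitProjection P A) = {x | limitProjection P A x = x} :=
    ext fun x => hP.mem_range_limitProjection hA
  rw [this]
  exact isClosed_eq (limitProjection P A).continuous continuous_id

theorem exists_mem_seqSups_apply_limitProjection (hP : IsOneProjectionalSkeleton P)
    (hA : DirectedOn (· ≤ ·) A) (hne : A.Nonempty) (x : X) :
    ∃ s ∈ seqSups A, P s (limitProjection P A x) = limitProjection P A x := by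
  have : Nonempty A := hne.to_subtype
  have : IsDirectedOrder A := ⟨fun a b => by
    obtain ⟨c, hc, h₁, h₂⟩ := hA a a.2 b b.2
    exact ⟨⟨c, hc⟩, h₁, h₂⟩⟩
  have h : ∀ n : ℕ, ∃ a : A, dist (P a x) (limitProjection P A x) < 1 / ((n : ℝ) + 1) := fun n =>
    ((hP.tendsto_limitProjection hA hne x).eventually
      (Metric.ball_mem_nhds _ Nat.one_div_pos_of_nat)).exists
  choose a ha using h
  have hlim : Tendsto (fun n => P (a n) x) atTop (𝓝 (limitProjection P A x)) :=
    tendsto_iff_dist_tendsto_zero.2 <| squeeze_zero (fun _ => dist_nonneg) (fun n => (ha n).le)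
      tendsto_one_div_add_atTop_nhds_zero_nat
  obtain ⟨s, hs, hle⟩ := hP.exists_mem_seqSups_forall_le hA (b := fun n => a n)
    fun n => subset_seqSups A (a n).2
  refine ⟨s, hs, tendsto_nhds_unique (((P s).continuous.tendsto _).comp hlim) <|
    hlim.congr fun n => (hP.apply_apply_of_ge (hle n) x).symm⟩

theorem exists_mem_seqSups_apply_comp (hP : IsOneProjectionalSkeleton P)
    (hA : DirectedOn (· ≤ ·) A) (hne : A.Nonempty) (t : Γ) {b : Γ} (hb : b ∈ seqSups A) :
    ∃ s ∈ seqSups A, b ≤ s ∧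
      ∀ x, P s (limitProjection P A (P t x)) = limitProjection P A (P t x) := by
  obtain ⟨C, hC, hsub⟩ := hP.separable t
  have hCne : C.Nonempty := by
    rw [← closure_nonempty_iff]
    exact (range_nonempty (P t)).mono hsub
  obtain ⟨c, rfl⟩ := hC.exists_eq_range hCne
  choose r hr hrc using fun k => hP.exists_mem_seqSups_apply_limitProjection hA hne (c k)
  -- The bound `b` takes position `0`, and the indices fixing the images of the dense points follow.
  obtain ⟨s, hs, hle⟩ := hP.exists_mem_seqSups_forall_le hA
    (b := fun n => Nat.casesOn n b r) fun n => by cases n <;> simp [hb, hr]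
  refine ⟨s, hs, hle 0, fun x => ?_⟩
  have hclosed : IsClosed {z | P s (limitProjection P A z) = limitProjection P A z} :=
    isClosed_eq ((P s).comp (limitProjection P A)).continuous (limitProjection P A).continuous
  refine closure_minimal ?_ hclosed (hsub (mem_range_self x))
  rintro _ ⟨k, rfl⟩
  change P s _ = _
  rw [← hrc k, hP.apply_apply_of_ge (hle (k + 1))]

/-- For cofinally many `t` the operator `P_A P_t` is a member of the skeleton with index in
`A_σ`. -/
theorem exists_limitProjection_comp_eq (hP : IsOneProjectionalSkeleton P)
    (hA : DirectedOn (· ≤ ·) A) (hne : A.Nonempty) (t₀ : Γ) :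
    ∃ t, t₀ ≤ t ∧ ∃ s ∈ sigmaClosure A, ∀ x, limitProjection P A (P t x) = P s x := by
  -- Two chains grow together, so that their suprema satisfy `s ≤ t` and `P_s` fixes `P_A P_t X`.
  -- Then `P_A P_t = P_s P_A P_t = P_s P_t = P_s`.
  have step : ∀ q : Γ × seqSups A, ∃ q' : Γ × seqSups A, q ≤ q' ∧ (q'.2 : Γ) ≤ q'.1 ∧
      ∀ x, P q'.2 (limitProjection P A (P q.1 x)) = limitProjection P A (P q.1 x) := by
    rintro ⟨t, b, hb⟩
    obtain ⟨s, hs, hbs, h⟩ := hP.exists_mem_seqSups_apply_comp hA hne t hb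
    obtain ⟨w, htw, hsw⟩ := hP.directed t s
    exact ⟨⟨w, s, hs⟩, ⟨htw, hbs⟩, hsw, h⟩
  choose g hg₁ hg₂ hg₃ using step
  obtain ⟨a, ha⟩ := hne
  let q : ℕ → Γ × seqSups A := fun n =>
    Nat.rec (t₀, ⟨a, subset_seqSups A ha⟩) (fun _ r => g r) n
  have hq : Monotone q := monotone_nat_of_le_succ fun n => hg₁ (q n)
  have hq₁ : Monotone fun n => (q n).1 := fun m n h => (hq h).1
  have hq₂ : Monotone fun n => ((q n).2 : Γ) := fun m n h => (hq h).2
  obtain ⟨t, ht, -⟩ := hP.exists_sup _ hq₁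
  obtain ⟨s, hs, -⟩ := hP.exists_sup _ hq₂
  have hsA : s ∈ sigmaClosure A := isSigmaClosed_sigmaClosure A _ hq₂
    (fun n => seqSups_subset_sigmaClosure A (q n).2.2) s hs
  have hst : s ≤ t := hs.2 <| by
    rintro _ ⟨n, rfl⟩
    exact (hq₂ n.le_succ).trans ((hg₂ (q n)).trans (ht.1 (mem_range_self (n + 1))))
  have hfix : ∀ x n, P s (limitProjection P A (P (q n).1 x)) =
      limitProjection P A (P (q n).1 x) := fun x n => by
    rw [← hg₃ (q n) x]
    exact hP.apply_apply_of_ge (hs.1 (mem_range_self (n + 1))) _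
  refine ⟨t, ht.1 (mem_range_self 0), s, hsA, fun x => ?_⟩
  have hlim := ((limitProjection P A).continuous.tendsto _).comp (hP.tendsto_of_isLUB hq₁ ht x)
  have h := tendsto_nhds_unique (((P s).continuous.tendsto _).comp hlim)
    (hlim.congr fun n => (hfix x n).symm)
  rw [← h, (hP.limitProjection_apply_of_mem hA hsA _).2, hP.apply_apply_of_le hst]

theorem exists_limitProjection_comp_comp (hP : IsOneProjectionalSkeleton P)
    (hA : DirectedOn (· ≤ ·) A) (t₀ : Γ) :
    ∃ t, t₀ ≤ t ∧ ∀ x, limitProjection P A (P t (limitProjection P A x)) =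
      limitProjection P A (P t x) := by
  rcases A.eq_empty_or_nonempty with rfl | hne
  · exact ⟨t₀, le_rfl, by simp [limitProjection_empty]⟩
  obtain ⟨t, ht, s, hs, h⟩ := hP.exists_limitProjection_comp_eq hA hne t₀
  exact ⟨t, ht, fun x => by rw [h, h, (hP.limitProjection_apply_of_mem hA hs x).2]⟩

/-- If `P_A X` is invariant under cofinally many projections, then cofinally many of them commute
with `P_A`. -/
theorem isCofinal_setOf_commute (hP : IsOneProjectionalSkeleton P) (hA : DirectedOn (· ≤ ·) A)
    (h : IsCofinal {s | MapsTo (P s) (range (limitProjection P A)) (range (limitProjection P A))}) :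
    IsCofinal {s | ∀ x, P s (limitProjection P A x) = limitProjection P A (P s x)} := by
  have step : ∀ s, ∃ t, s ≤ t ∧ ∃ r r', s ≤ r ∧ r ≤ t ∧ s ≤ r' ∧ r' ≤ t ∧
      MapsTo (P r) (range (limitProjection P A)) (range (limitProjection P A)) ∧
      ∀ x, limitProjection P A (P r' (limitProjection P A x)) =
        limitProjection P A (P r' x) := fun s => by
    obtain ⟨r, hr, hsr⟩ := h s
    obtain ⟨r', hsr', hr'⟩ := hP.exists_limitProjection_comp_comp hA s
    obtain ⟨t, ht, ht'⟩ := hP.directed r r'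
    exact ⟨t, hsr.trans ht, r, r', hsr, ht, hsr', ht', hr, hr'⟩
  intro s₀
  obtain ⟨u, t, rfl, hu, ht, hstep⟩ := hP.exists_chain step s₀
  choose r r' hr₁ hr₂ hr'₁ hr'₂ hr hr' using hstep
  -- Both `r` and `r'` are squeezed between consecutive terms of `u`, so `t` inherits both
  -- properties.
  have interleaved : ∀ v : ℕ → Γ, (∀ n, u n ≤ v n) → (∀ n, v n ≤ u (n + 1)) →
      Monotone v ∧ IsLUB (range v) t := fun v h₁ h₂ => by
    refine ⟨monotone_nat_of_le_succ fun n => (h₂ n).trans (h₁ (n + 1)), ?_, fun w hw => ht.2 ?_⟩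
    · rintro _ ⟨n, rfl⟩
      exact (h₂ n).trans (ht.1 (mem_range_self _))
    · rintro _ ⟨n, rfl⟩
      exact (h₁ n).trans (hw (mem_range_self n))
  refine ⟨t, fun x => ?_, ht.1 (mem_range_self 0)⟩
  obtain ⟨hm, hl⟩ := interleaved r hr₁ hr₂
  obtain ⟨hm', hl'⟩ := interleaved r' hr'₁ hr'₂
  have h₁ := hP.isSigmaClosed_setOf_mapsTo (hP.isClosed_range_limitProjection hA) r hm hr t hl
  have h₂ := hP.isSigmaClosed_setOf_eq (limitProjection P A).continuous
    (limitProjection P A).continuous (limitProjection P A) id r' hm' hr' t hl' x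
  exact ((hP.mem_range_limitProjection hA).1 (h₁ (mem_range_self x))).symm.trans h₂

/-! ### Comparison of `D_A` with the restrictions of `D`. -/

/-- A functional on `X` belongs to `D_A` after restriction to `P_A X` as soon as it is invariant
on `P_A X` under some `P_s` with `s ∈ A_σ`. -/
theorem comp_subtypeL_mem_inducedSubspaceOn (hP : IsOneProjectionalSkeleton P)
    (hA : DirectedOn (· ≤ ·) A) {s : Γ} (hs : s ∈ sigmaClosure A) {f : StrongDual 𝕜 X}
    (hf : ∀ x, f (P s (limitProjection P A x)) = f (limitProjection P A x)) :
    f ∘L (limitProjection P A).range.subtypeL ∈ inducedSubspaceOn P A := by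
  refine Or.inr ⟨s, hs, (P s ∘L (limitProjection P A).range.subtypeL).codRestrict _ fun y =>
    ⟨P s y, (hP.limitProjection_apply_of_mem hA hs _).1⟩, fun y => rfl,
    f ∘L (limitProjection P A).range.subtypeL, ?_⟩
  ext ⟨_, x, rfl⟩
  exact (hf x).symm

/-- Restriction of functionals always maps `D` onto a superset of `D_A`. -/
theorem inducedSubspaceOn_subset (hP : IsOneProjectionalSkeleton P)
    (hA : DirectedOn (· ≤ ·) A) :
    inducedSubspaceOn P A ⊆
      (fun f : StrongDual 𝕜 X => f ∘L (limitProjection P A).range.subtypeL) ''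
        inducedSubspace P := by
  rintro g (hg | ⟨s, hs, R, hR, f, rfl⟩)
  · exact ⟨0, hP.zero_mem_inducedSubspace, by rw [hg]; rfl⟩
  -- For `s ∈ A_σ`, `P s` maps all of `X` into `P_A X`, so `f ∘ R` extends to `X` through `P s`.
  let S : X →L[𝕜] (limitProjection P A).range := (P s).codRestrict _ fun y =>
    ⟨P s y, (hP.limitProjection_apply_of_mem hA hs _).1⟩
  have hS : (f ∘L S) ∘L P s = f ∘L S := by
    ext x
    exact congrArg f (Subtype.ext (hP.apply_apply_of_le le_rfl x))
  refine ⟨f ∘L S, hS ▸ comp_mem_inducedSubspace _ s, ?_⟩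
  ext y
  exact congrArg f (Subtype.ext (hR y).symm)

/-- Functionals in `D_A`, composed with `P_A`, belong to `D`. -/
theorem comp_limitProjection_mem (hP : IsOneProjectionalSkeleton P) (hA : DirectedOn (· ≤ ·) A)
    {f : StrongDual 𝕜 X}
    (hf : f ∘L (limitProjection P A).range.subtypeL ∈ inducedSubspaceOn P A) :
    f ∘L limitProjection P A ∈ inducedSubspace P := by
  have happ : ∀ x, f (limitProjection P A x) =
      (f ∘L (limitProjection P A).range.subtypeL) ⟨limitProjection P A x, x, rfl⟩ := fun _ => rfl
  rcases hf with hf | ⟨s, hs, R, hR, g, hg⟩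
  · have : f ∘L limitProjection P A = 0 := by
      ext x
      change f (limitProjection P A x) = 0
      rw [happ, hf]
      rfl
    exact this ▸ hP.zero_mem_inducedSubspace
  have : f ∘L limitProjection P A = (f ∘L limitProjection P A) ∘L P s := by
    ext x
    change f (limitProjection P A x) = f (limitProjection P A (P s x))
    rw [happ, happ, hg]
    refine congrArg g (Subtype.ext ?_)
    refine (hR _).trans (Eq.trans ?_ (hR _).symm)
    change P s (limitProjection P A x) = P s (limitProjection P A (P s x))
    rw [(hP.limitProjection_apply_of_mem hA hs _).2, (hP.limitProjection_apply_of_mem hA hs _).2,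
      hP.apply_apply_of_le le_rfl]
  exact this ▸ comp_mem_inducedSubspace _ s

theorem inducedSubspaceOn_eq_iff (hP : IsOneProjectionalSkeleton P) (hA : DirectedOn (· ≤ ·) A) :
    inducedSubspaceOn P A =
        (fun f : StrongDual 𝕜 X => f ∘L (limitProjection P A).range.subtypeL) ''
          inducedSubspace P ↔
      ∀ f ∈ inducedSubspace P, f ∘L limitProjection P A ∈ inducedSubspace P := by
  refine ⟨fun h f hf => hP.comp_limitProjection_mem hA (h ▸ mem_image_of_mem _ hf),
    fun h => (hP.inducedSubspaceOn_subset hA).antisymm ?_⟩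
  rintro _ ⟨f, hf, rfl⟩
  rcases A.eq_empty_or_nonempty with rfl | hne
  · refine Or.inl ?_
    ext ⟨_, x, rfl⟩
    simp [limitProjection_empty]
  obtain ⟨t₀, ht₀⟩ := hP.exists_comp_eq (h f hf)
  obtain ⟨t, ht, s, hs, hts⟩ := hP.exists_limitProjection_comp_eq hA hne t₀
  refine hP.comp_subtypeL_mem_inducedSubspaceOn hA hs fun x => ?_
  -- `P_s P_A = P_s = P_A P_t`, and `f P_A P_t = f P_A` since `f P_A ∈ D` and `t` is large.
  rw [(hP.limitProjection_apply_of_mem hA hs x).2, ← hts]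
  exact ht₀ t ht x

end IsOneProjectionalSkeleton

theorem propositionP {𝕜 X Γ : Type*} [RCLike 𝕜] [NormedAddCommGroup X] [NormedSpace 𝕜 X]
    [CompleteSpace X] [PartialOrder Γ] (P : Γ → X →L[𝕜] X) (hP : IsOneProjectionalSkeleton P)
    (A : Set Γ) (hA : DirectedOn (· ≤ ·) A) :
    List.TFAE [
      ∀ f ∈ inducedSubspace P, f ∘L limitProjection P A ∈ inducedSubspace P,
      Continuous[sigmaTopology (inducedSubspace P), sigmaTopology (inducedSubspace P)]
        (limitProjection P A),
      IsClosed[sigmaTopology (inducedSubspace P)] (range (limitProjection P A)),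
      ∃ Γ' : Set Γ, IsCofinal Γ' ∧ IsSigmaClosed Γ' ∧
        ∀ s ∈ Γ', P s '' range (limitProjection P A) ⊆ range (limitProjection P A),
      ∃ Γ' : Set Γ, IsCofinal Γ' ∧ IsSigmaClosed Γ' ∧
        ∀ s ∈ Γ', P s ∘L limitProjection P A = limitProjection P A ∘L P s,
      inducedSubspaceOn P A =
        (fun f : StrongDual 𝕜 X => f ∘L (limitProjection P A).range.subtypeL) ''
          inducedSubspace P] := by
  tfae_have 1 → 2 := fun h => IsProjectionalSkeleton.continuous_sigmaTopology h
  tfae_have 2 → 3 := fun h => hP.isClosed_range_of_continuous (hP.limitProjection_idem hA) h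
  tfae_have 3 → 4 := fun h => ⟨_, hP.isCofinal_setOf_mapsTo h,
    hP.isSigmaClosed_setOf_mapsTo (hP.isClosed_range_limitProjection hA),
    fun s hs => hs.image_subset⟩
  tfae_have 4 → 5 := by
    rintro ⟨Γ', hcof, -, h⟩
    refine ⟨_, hP.isCofinal_setOf_commute hA
      (hcof.mono fun s hs => mapsTo_iff_image_subset.2 (h s hs)), ?_, fun s hs => ContinuousLinearMap.ext hs⟩
    intro u hu hc s hs x
    exact tendsto_nhds_unique (hP.tendsto_of_isLUB hu hs _)
      ((((limitProjection P A).continuous.tendsto _).comp (hP.tendsto_of_isLUB hu hs x)).congr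
        fun n => (hc n x).symm)
  tfae_have 5 → 1 := by
    rintro ⟨Γ', hcof, -, h⟩ f hf
    obtain ⟨s, hs⟩ := hP.exists_comp_eq hf
    obtain ⟨t, ht, hst⟩ := hcof s
    have : f ∘L limitProjection P A = (f ∘L limitProjection P A) ∘L P t := by
      rw [ContinuousLinearMap.comp_assoc, ← h t ht]
      ext x
      exact (hs t hst _).symm
    exact this ▸ comp_mem_inducedSubspace _ t
  tfae_have 6 ↔ 1 := hP.inducedSubspaceOn_eq_iff hA
  tfae_finish
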